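/- There are absolute constants $C_s, C_t>0$ and one fixed program $P$ for a unit-cost real RAM (using only additions, subtractions and multiplications of reals, counter and address arithmetic, and indirect memory access) such that the following holds. For every $c>0$ there is a constant $C_d>0$ such that for all integers $n\ge 2$, all $0<\varepsilon\le 1$ and every integer $d\ge C_d\,\frac{\log n}{\varepsilon^2}$ (in particular for some $d=\mathcal O(\frac{\log n}{\varepsilon^2})$), there are an integer $s$ with $1\le s\le C_s\,d\varepsilon$ and a probability distribution $\mathcal F$ on linear maps $\varphi:\mathbb R^d\times\mathbb R^d\to\mathbb R^d$ such that: 1. Every $\varphi$ in the support of $\mathcal F$ has the form $\varphi(x,y)=A_0x+A_1y$ with $d\times d$ matrices $A_0,A_1$ all of whose entries lie in $\{-\frac1{\sqrt s},0,\frac1{\sqrt s}\}$, where each column of $A_0$ and each column of $A_1$ has exactly $s$ non-zero entries. 2. For every such $\varphi$ and all $x,y\in\mathbb R^d$, the program $P$, given $d$, $s$, the sparse column-by-column list of the non-zero entries of $A_0,A_1$ (row numbers and values), and $x,y$, computes $\varphi(x,y)$ in at most $C_t\,d^2\varepsilon$ steps; hence, whenever $d\le D\,\frac{\log n}{\varepsilon^2}$,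 in at most $C_tD^2\,\frac{\log^2 n}{\varepsilon^3}$ steps. 3. For all fixed $x,y\in\mathbb R^d$ (Euclidean norms), $$\Pr_{\varphi\sim\mathcal F}\Big((1-\varepsilon)(\|x\|^2+\|y\|^2)\le\|\varphi(x,y)\|^2\le(1+\varepsilon)(\|x\|^2+\|y\|^2)\Big)\ \ge\ 1-n^{-c}.$$ -/

import Mathlib

/-! ### A unit-cost real RAM -/

namespace RealRAM

/-- The memory of the machine: cells holding natural numbers (used for counters and addresses)
and cells holding real numbers. -/
structure State where
  nats : ℕ → ℕ
  reals : ℕ → ℝ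

/-- The elementary instructions. In the comments `N` is the natural-number memory and `R` the
real memory. -/
inductive Instr where
  /-- `N[i] := c` -/
  | natConst (i c : ℕ)
  /-- `N[i] := N[j] + N[k]` -/
  | natAdd (i j k : ℕ)
  /-- `N[i] := N[j] - N[k]`, truncated at zero -/
  | natSub (i j k : ℕ)
  /-- `N[i] := N[N[j]]` -/
  | natLoad (i j : ℕ)
  /-- `N[N[i]] := N[j]` -/
  | natStore (i j : ℕ)
  /-- `R[i] := c` -/
  | realConst (i : ℕ) (c : ℤ)
  /-- `R[i] := R[j] + R[k]` -/
  | realAdd (i j k : ℕ)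
  /-- `R[i] := R[j] - R[k]` -/
  | realSub (i j k : ℕ)
  /-- `R[i] := R[j] * R[k]` -/
  | realMul (i j k : ℕ)
  /-- `R[i] := R[N[j]]` -/
  | realLoad (i j : ℕ)
  /-- `R[N[i]] := R[j]` -/
  | realStore (i j : ℕ)

/-- The effect of one elementary instruction on the memory. -/
noncomputable def Instr.apply : Instr → State → State
  | .natConst i c, σ => { σ with nats := Function.update σ.nats i c }
  | .natAdd i j k, σ => { σ with nats := Function.update σ.nats i (σ.nats j + σ.nats k) }
  | .natSub i j k, σ => { σ with nats := Function.update σ.nats i (σ.nats j - σ.nats k) }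
  | .natLoad i j, σ => { σ with nats := Function.update σ.nats i (σ.nats (σ.nats j)) }
  | .natStore i j, σ => { σ with nats := Function.update σ.nats (σ.nats i) (σ.nats j) }
  | .realConst i c, σ => { σ with reals := Function.update σ.reals i (c : ℝ) }
  | .realAdd i j k, σ => { σ with reals := Function.update σ.reals i (σ.reals j + σ.reals k) }
  | .realSub i j k, σ => { σ with reals := Function.update σ.reals i (σ.reals j - σ.reals k) }
  | .realMul i j k, σ => { σ with reals := Function.update σ.reals i (σ.reals j * σ.reals k) }
  | .realLoad i j, σ => { σ with reals := Function.update σ.reals i (σ.reals (σ.nats j)) }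
  | .realStore i j, σ => { σ with reals := Function.update σ.reals (σ.nats i) (σ.reals j) }

/-- Programs: elementary instructions, sequential composition, and loops
`while N[i] ≠ 0 do p`. -/
inductive Prog where
  | instr (a : Instr)
  | seq (p q : Prog)
  | loop (i : ℕ) (p : Prog)

/-- `Exec p σ t σ'`: started in memory `σ`, the program `p` halts after exactly `t` steps in
memory `σ'`. Every elementary instruction and every test of a loop condition is one step. -/
inductive Exec : Prog → State → ℕ → State → Prop where
  | instr (a : Instr) (σ : State) : Exec (.instr a) σ 1 (a.apply σ)
  | seq {p q : Prog} {σ σ' σ'' : State} {t t' : ℕ} :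
      Exec p σ t σ' → Exec q σ' t' σ'' → Exec (.seq p q) σ (t + t') σ''
  | loopStop {i : ℕ} {p : Prog} {σ : State} : σ.nats i = 0 → Exec (.loop i p) σ 1 σ
  | loopStep {i : ℕ} {p : Prog} {σ σ' σ'' : State} {t t' : ℕ} : σ.nats i ≠ 0 →
      Exec p σ t σ' → Exec (.loop i p) σ' t' σ'' → Exec (.loop i p) σ (1 + t + t') σ''

end RealRAM

/-! ### Sparse matrices and their representation in memory -/

namespace SparseMap

/-- Every entry of `A` lies in `{-1/√s, 0, 1/√s}` and every column of `A` has exactly `s`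
non-zero entries. -/
def IsSparseSign {d : ℕ} (s : ℕ) (A : Matrix (Fin d) (Fin d) ℝ) : Prop :=
  (∀ i j, A i j = -(1 / Real.sqrt s) ∨ A i j = 0 ∨ A i j = 1 / Real.sqrt s) ∧
    ∀ j, {i | A i j ≠ 0}.ncard = s

/-- Column `j` of the `d × 2d` matrix `[A₀ | A₁]` (and zero for `j ≥ 2d`). -/
noncomputable def column {d : ℕ} (A₀ A₁ : Matrix (Fin d) (Fin d) ℝ) (j : ℕ) (i : Fin d) : ℝ :=
  if h : j < d then A₀ i ⟨j, h⟩ else if h : j - d < d then A₁ i ⟨j - d, h⟩ else 0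

open scoped Classical in
/-- The list of the non-zero entries of column `j` of `[A₀ | A₁]`, from top to bottom, each given
as a pair (row number, value). -/
noncomputable def columnList {d : ℕ} (A₀ A₁ : Matrix (Fin d) (Fin d) ℝ) (j : ℕ) :
    List (ℕ × ℝ) :=
  ((List.finRange d).filter fun i : Fin d => column A₀ A₁ j i ≠ 0).map
    fun i : Fin d => ((i : ℕ), column A₀ A₁ j i)

/-- When every column has `s` non-zero entries: the `e`-th non-zero entry of `[A₀ | A₁]`, column
after column, as a pair (row number, value). -/
noncomputable def entry {d : ℕ} (s : ℕ) (A₀ A₁ : Matrix (Fin d) (Fin d) ℝ) (e : ℕ) : ℕ × ℝ :=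
  (columnList A₀ A₁ (e / s)).getD (e % s) (0, 0)

/-- The initial memory for evaluating `A₀ x + A₁ y`, with `[A₀ | A₁]` stored by columns in sparse
form.

* Natural-number memory: `d` and `s` in cells `0` and `1`, and from cell `16` on the row numbers of
  the `2 d s` non-zero entries.
* Real memory: cells `16, …, 15 + d` are reserved for the output; `x` is in the next `d` cells, `y`
  in the next `d` cells, and the values of the `2 d s` non-zero entries follow.

All other cells, and the cells reserved for the output, hold zero. -/
noncomputable def initState {d : ℕ} (s : ℕ) (A₀ A₁ : Matrix (Fin d) (Fin d) ℝ)
    (x y : EuclideanSpace ℝ (Fin d)) : RealRAM.State where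
  nats a :=
    if a = 0 then d
    else if a = 1 then s
    else if a < 16 then 0
    else (entry s A₀ A₁ (a - 16)).1
  reals a :=
    if a < 16 + d then 0
    else if h : a - (16 + d) < d then x ⟨a - (16 + d), h⟩
    else if h : a - (16 + 2 * d) < d then y ⟨a - (16 + 2 * d), h⟩
    else (entry s A₀ A₁ (a - (16 + 3 * d))).2

/-- The program `P` evaluates `v = A₀ x + A₁ y` in at most `T` steps: started on the sparse
representation of `A₀, A₁` together with `x, y`, it halts within `T` steps with the coordinates of
`v` in the output cells. -/
def EvaluatesWithin {d : ℕ} (P : RealRAM.Prog) (s : ℕ) (A₀ A₁ : Matrix (Fin d) (Fin d) ℝ)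
    (x y v : EuclideanSpace ℝ (Fin d)) (T : ℝ) : Prop :=
  ∃ (t : ℕ) (σ : RealRAM.State), RealRAM.Exec P (initState s A₀ A₁ x y) t σ ∧
    (t : ℝ) ≤ T ∧ ∀ i : Fin d, σ.reals (16 + i) = v i

end SparseMap

/-! Stack `x` and `y` into one vector `z` of length `2d`. Divide (most of) the `d` rows into `s =
⌊d/k⌋` blocks of `k = ⌈2/ε⌉` rows. In each block, every coordinate goes to one random bucket with a
random sign, so each column has one non-zero entry per block, `s` in all.

For a unit vector, let `X` be the squared norm in one block before scaling. Given the hash function,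
`X - 1` is a sign chaos over colliding pairs, and its exponential moment at `θ = ±1/8` is at most
`exp(W/16)`, where `W` is the collision weight `∑_{i≠j} z_i² z_j² [h i = h j]`
(`sum_exp_bucketSum_sq_le`). Since `W ≤ 1` and `W` has mean at most `1/k`, averaging over hash
functions gives `E exp(θ(X-1)) ≤ exp(1/(8k)) ≤ exp(ε/16)` (`sum_exp_sketchSq_le`). A constant `θ`
therefore suffices: over `s` independent blocks, Markov's inequality bounds the failure probability
by `2 exp(-sε/16)`. As `sε` is of order `dε²`, this is at most `n^{-c}` once `d ≥ C log n / ε²`.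

Time: the matrices have `2ds ≤ 2d²ε` non-zero entries, and the program spends a bounded number of
steps on each (`evaluatesWithin_mulVecProg`). Probabilities are handled as counts over finite sets.
-/

namespace RealRAM

/-! ### Running straight-line code and counting loops. -/

/-- A non-empty sequence of elementary instructions, as a program. -/
def block : Instr → List Instr → Prog
  | a, [] => .instr a
  | a, b :: l => .seq (.instr a) (block b l)

theorem exec_block (a : Instr) (l : List Instr) (σ : State) :
    Exec (block a l) σ (l.length + 1) (l.foldl (fun σ b => b.apply σ) (a.apply σ)) := by
  induction l generalizing a σ with
  | nil => exact .instr a σ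
  | cons b l ih =>
    have := Exec.seq (.instr a σ) (ih b (a.apply σ))
    rwa [add_comm 1] at this

/-- A counting loop whose body takes `T` steps and decreases the counter, with invariant `I`. -/
theorem exec_loop {i T : ℕ} {p : Prog} (I : ℕ → State → Prop) (hI : ∀ n σ, I n σ → σ.nats i = n)
    (hstep : ∀ n σ, I (n + 1) σ → ∃ σ', Exec p σ T σ' ∧ I n σ') (n : ℕ) (σ : State) (h : I n σ) :
    ∃ σ', Exec (.loop i p) σ (n * (T + 1) + 1) σ' ∧ I 0 σ' := by
  induction n generalizing σ with
  | zero => exact ⟨σ, by simpa using Exec.loopStop (hI 0 σ h), h⟩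
  | succ n ih =>
    obtain ⟨σ', h1, h2⟩ := hstep n σ h
    obtain ⟨σ'', h3, h4⟩ := ih σ' h2
    refine ⟨σ'', ?_, h4⟩
    have := Exec.loopStep (by rw [hI _ σ h]; omega) h1 h3
    convert this using 1
    ring

end RealRAM

/-! ### The multiplication program and its invariant. -/

namespace SparseMap

open RealRAM

/-- Add the contribution of one non-zero entry to the output. -/
def entryProg : Prog :=
  -- Natural cells: 2 holds the output base 16; 3, 4, 5 point to row numbers, input, values; 6 and 8
  -- count the remaining columns and entries; 7 holds 1; 9 holds 0; 10 is scratch. Real cell 0 holds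
  -- the current input coordinate; 1 and 2 are scratch.
  block (.natSub 8 8 7) [.natLoad 10 3, .natAdd 10 10 2, .realLoad 1 5, .realMul 1 1 0,
    .realLoad 2 10, .realAdd 2 2 1, .realStore 10 2, .natAdd 3 3 7, .natAdd 5 5 7]

/-- Add the contribution of one column to the output. -/
def columnProg : Prog :=
  -- Adding the zero in cell 9 copies `s` into the counter 8.
  .seq (block (.natSub 6 6 7) [.realLoad 0 4, .natAdd 4 4 7, .natAdd 8 1 9]) (.loop 8 entryProg)

/-- Sparse matrix-vector multiplication. -/
def mulVecProg : Prog :=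
  .seq (block (.natConst 2 16) [.natConst 7 1, .natConst 3 16, .natAdd 4 2 0, .natAdd 5 4 0,
    .natAdd 5 5 0, .natAdd 6 0 0]) (.loop 6 columnProg)

/-- The memory after the first `e` non-zero entries have been processed, with the pointer to the
input at position `j`. -/
structure Progress (d s : ℕ) (row : ℕ → ℕ) (val z : ℕ → ℝ) (j e : ℕ) (σ : State) : Prop where
  n1 : σ.nats 1 = s
  n2 : σ.nats 2 = 16
  n3 : σ.nats 3 = 16 + e
  n4 : σ.nats 4 = 16 + d + j
  n5 : σ.nats 5 = 16 + 3 * d + e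
  n7 : σ.nats 7 = 1
  n9 : σ.nats 9 = 0
  rows : ∀ e, σ.nats (16 + e) = row e
  input : ∀ j < 2 * d, σ.reals (16 + d + j) = z j
  vals : ∀ e, σ.reals (16 + 3 * d + e) = val e
  -- Each column contributes exactly `s` entries, so entry `e'` lies in column `e' / s`.
  output : ∀ i < d, σ.reals (16 + i) =
    ∑ e' ∈ Finset.range e, if row e' = i then val e' * z (e' / s) else 0

variable {d s : ℕ} {row : ℕ → ℕ} {val z : ℕ → ℝ}

/-- The input pointer is already at `j + 1` because `z j` was loaded before the inner loop. The
bound on `row e` keeps the indirect store inside the output area, away from input and values. -/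
theorem exec_entryProg {j e n q : ℕ} {σ : State} (h : Progress d s row val z (j + 1) e σ)
    (h6 : σ.nats 6 = q) (h8 : σ.nats 8 = n + 1) (h0 : σ.reals 0 = z j) (hj : e / s = j)
    (hrow : row e < d) :
    ∃ σ', Exec entryProg σ 10 σ' ∧ Progress d s row val z (j + 1) (e + 1) σ' ∧
      σ'.nats 6 = q ∧ σ'.nats 8 = n ∧ σ'.reals 0 = z j := by
  obtain ⟨n1, n2, n3, n4, n5, n7, n9, rows, input, vals, output⟩ := h
  have hout := output (row e) hrow
  obtain ⟨σ', hσ'⟩ : ∃ σ', σ' = [Instr.natLoad 10 3, .natAdd 10 10 2, .realLoad 1 5,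
    .realMul 1 1 0, .realLoad 2 10, .realAdd 2 2 1, .realStore 10 2, .natAdd 3 3 7,
    .natAdd 5 5 7].foldl (fun σ b => b.apply σ) (Instr.apply (.natSub 8 8 7) σ) := ⟨_, rfl⟩
  have hn : ∀ a, a ≠ 3 → a ≠ 5 → a ≠ 8 → a ≠ 10 → σ'.nats a = σ.nats a := by
    intro a h3 h5 h8 h10
    simp [hσ', Instr.apply, Function.update_apply, h3, h5, h8, h10]
  have hn3 : σ'.nats 3 = 16 + (e + 1) := by
    simp [hσ', Instr.apply, Function.update_apply, n3, n7, add_assoc]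
  have hn5 : σ'.nats 5 = 16 + 3 * d + (e + 1) := by
    simp [hσ', Instr.apply, Function.update_apply, n5, n7, add_assoc]
  have hn8 : σ'.nats 8 = n := by
    simp [hσ', Instr.apply, Function.update_apply, h8, n7]
  have hr : ∀ a, a ≠ 1 → a ≠ 2 → σ'.reals a =
      if a = 16 + row e then σ.reals (16 + row e) + val e * z j else σ.reals a := by
    intro a h1 h2
    have e1 : 16 + e ≠ 8 := by omega
    have e2 : 16 + row e ≠ 1 := by omega
    simp [hσ', Instr.apply, Function.update_apply, h1, h2, n2, n3, n5, h0, rows, vals, e1, e2,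
      add_comm (row e) 16]
  refine ⟨σ', hσ' ▸ exec_block _ _ _, ⟨?_, ?_, hn3, ?_, hn5, ?_, ?_, ?_, ?_, ?_, ?_⟩, ?_, hn8, ?_⟩
  · rw [hn _ (by omega) (by omega) (by omega) (by omega), n1]
  · rw [hn _ (by omega) (by omega) (by omega) (by omega), n2]
  · rw [hn _ (by omega) (by omega) (by omega) (by omega), n4]
  · rw [hn _ (by omega) (by omega) (by omega) (by omega), n7]
  · rw [hn _ (by omega) (by omega) (by omega) (by omega), n9]
  · intro e'
    rw [hn _ (by omega) (by omega) (by omega) (by omega), rows]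
  · intro j' hj'
    rw [hr _ (by omega) (by omega), if_neg (by omega), input j' hj']
  · intro e'
    rw [hr _ (by omega) (by omega), if_neg (by omega), vals]
  · intro i hi
    rw [hr _ (by omega) (by omega), Finset.sum_range_succ, hj]
    by_cases hie : row e = i
    · subst hie
      simp [hout]
    · rw [if_neg (by omega), if_neg hie, output i hi, add_zero]
  · rw [hn _ (by omega) (by omega) (by omega) (by omega), h6]
  · rw [hr _ (by omega) (by omega), if_neg (by omega), h0]

theorem exec_columnProg {j n : ℕ} {σ : State} (h : Progress d s row val z j (j * s) σ)
    (h6 : σ.nats 6 = n + 1) (hj : j < 2 * d) (hrow : ∀ e < 2 * d * s, row e < d) :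
    ∃ σ', Exec columnProg σ (4 + (s * 11 + 1)) σ' ∧
      Progress d s row val z (j + 1) ((j + 1) * s) σ' ∧ σ'.nats 6 = n := by
  obtain ⟨n1, n2, n3, n4, n5, n7, n9, rows, input, vals, output⟩ := h
  obtain ⟨σ₁, hσ₁⟩ : ∃ σ', σ' = [Instr.realLoad 0 4, .natAdd 4 4 7, .natAdd 8 1 9].foldl
    (fun σ b => b.apply σ) (Instr.apply (.natSub 6 6 7) σ) := ⟨_, rfl⟩
  have hn : ∀ a, a ≠ 4 → a ≠ 6 → a ≠ 8 → σ₁.nats a = σ.nats a := by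
    intro a h4 h6 h8
    simp [hσ₁, Instr.apply, h4, h6, h8]
  have hn4 : σ₁.nats 4 = 16 + d + (j + 1) := by
    simp [hσ₁, Instr.apply, n4, n7, add_assoc]
  have hn6 : σ₁.nats 6 = n := by
    simp [hσ₁, Instr.apply, h6, n7]
  have hn8 : σ₁.nats 8 = s := by
    simp [hσ₁, Instr.apply, n1, n9]
  have hr0 : σ₁.reals 0 = z j := by
    simp [hσ₁, Instr.apply, n4, input j hj]
  have hr : ∀ a, a ≠ 0 → σ₁.reals a = σ.reals a := by
    intro a h0
    simp [hσ₁, Instr.apply, h0]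
  have hp : Progress d s row val z (j + 1) (j * s) σ₁ := by
    refine ⟨?_, ?_, ?_, hn4, ?_, ?_, ?_, ?_, ?_, ?_, ?_⟩
    · rw [hn _ (by omega) (by omega) (by omega), n1]
    · rw [hn _ (by omega) (by omega) (by omega), n2]
    · rw [hn _ (by omega) (by omega) (by omega), n3]
    · rw [hn _ (by omega) (by omega) (by omega), n5]
    · rw [hn _ (by omega) (by omega) (by omega), n7]
    · rw [hn _ (by omega) (by omega) (by omega), n9]
    · intro e'
      rw [hn _ (by omega) (by omega) (by omega), rows]
    · intro j' hj'
      rw [hr _ (by omega), input j' hj']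
    · intro e'
      rw [hr _ (by omega), vals]
    · intro i hi
      rw [hr _ (by omega), output i hi]
  obtain ⟨σ₂, h1, m, hm, h2, h3, -⟩ := exec_loop (i := 8) (p := entryProg) (T := 10)
    (fun k σ => ∃ m, m + k = s ∧ Progress d s row val z (j + 1) (j * s + m) σ ∧
      σ.nats 6 = n ∧ σ.nats 8 = k ∧ σ.reals 0 = z j)
    (fun k σ ⟨_, _, _, _, h, _⟩ => h)
    (fun k σ ⟨m, hm, h1, h2, h3, h4⟩ => by
      -- Entry `j * s + m` with `m < s` belongs to column `j`, and its index is below `2 * d * s`.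
      have hlt : j * s + m < (j + 1) * s := by
        rw [add_mul]
        omega
      have hle : (j + 1) * s ≤ 2 * d * s := Nat.mul_le_mul_right _ hj
      obtain ⟨σ', e1, e2, e3, e4, e5⟩ := exec_entryProg h1 h2 h3 h4
        (Nat.div_eq_of_lt_le (by omega) hlt) (hrow _ (by omega))
      exact ⟨σ', e1, m + 1, by omega, e2, e3, e4, e5⟩)
    s σ₁ ⟨0, by omega, hp, hn6, hn8, hr0⟩
  refine ⟨σ₂, Exec.seq (hσ₁ ▸ exec_block _ _ _) h1, ?_, h3⟩
  obtain rfl : m = s := by omega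
  rwa [add_mul, one_mul]

/-- Step count: 7 for set-up; per column, 4 plus 11 per entry (10 and a loop test), the failing
inner test and one outer test; finally the failing outer test. -/
theorem exec_mulVecProg {σ : State} (hd : σ.nats 0 = d) (hs : σ.nats 1 = s) (h9 : σ.nats 9 = 0)
    (rows : ∀ e, σ.nats (16 + e) = row e) (input : ∀ j < 2 * d, σ.reals (16 + d + j) = z j)
    (vals : ∀ e, σ.reals (16 + 3 * d + e) = val e) (output : ∀ i < d, σ.reals (16 + i) = 0)
    (hrow : ∀ e < 2 * d * s, row e < d) :
    ∃ σ', Exec mulVecProg σ (7 + (2 * d * (4 + (s * 11 + 1) + 1) + 1)) σ' ∧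
      ∀ i < d, σ'.reals (16 + i) =
        ∑ e ∈ Finset.range (2 * d * s), if row e = i then val e * z (e / s) else 0 := by
  obtain ⟨σ₁, hσ₁⟩ : ∃ σ', σ' = [Instr.natConst 7 1, .natConst 3 16, .natAdd 4 2 0, .natAdd 5 4 0,
    .natAdd 5 5 0, .natAdd 6 0 0].foldl
    (fun σ b => b.apply σ) (Instr.apply (.natConst 2 16) σ) := ⟨_, rfl⟩
  have hr : σ₁.reals = σ.reals := by simp [hσ₁, Instr.apply]
  have hp : Progress d s row val z 0 (0 * s) σ₁ := by
    refine ⟨?_, ?_, ?_, ?_, ?_, ?_, ?_, ?_, ?_, ?_, ?_⟩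
    · simp [hσ₁, Instr.apply, hs]
    · simp [hσ₁, Instr.apply]
    · simp [hσ₁, Instr.apply]
    · simp [hσ₁, Instr.apply, hd]
    · simp [hσ₁, Instr.apply, hd]
      ring
    · simp [hσ₁, Instr.apply]
    · simp [hσ₁, Instr.apply, h9]
    · intro e
      have h1 : ∀ k < 16, 16 + e ≠ k := by omega
      simp [hσ₁, Instr.apply, h1, rows]
    · rw [hr]
      exact input
    · rw [hr]
      exact vals
    · rw [hr]
      simpa using output
  have h6 : σ₁.nats 6 = 2 * d := by
    simp [hσ₁, Instr.apply, hd, two_mul]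
  obtain ⟨σ₂, h1, j, hj, h2, -⟩ := exec_loop (i := 6) (p := columnProg) (T := 4 + (s * 11 + 1))
    (fun n σ => ∃ j, j + n = 2 * d ∧ Progress d s row val z j (j * s) σ ∧ σ.nats 6 = n)
    (fun n σ ⟨_, _, _, h⟩ => h)
    (fun n σ ⟨j, hj, h1, h2⟩ => by
      obtain ⟨σ', e1, e2, e3⟩ := exec_columnProg h1 h2 (by omega) hrow
      exact ⟨σ', e1, j + 1, by omega, e2, e3⟩)
    (2 * d) σ₁ ⟨0, by omega, hp, h6⟩
  refine ⟨σ₂, Exec.seq (hσ₁ ▸ exec_block _ _ _) h1, ?_⟩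
  rw [add_zero] at hj
  exact hj ▸ h2.output

/-! ### From the flat list of entries back to the matrix product. -/

section Column

variable {d s : ℕ} {A₀ A₁ : Matrix (Fin d) (Fin d) ℝ}

lemma length_columnList (h₀ : IsSparseSign s A₀) (h₁ : IsSparseSign s A₁) {j : ℕ}
    (hj : j < 2 * d) : (columnList A₀ A₁ j).length = s := by
  classical
  have h : {i | column A₀ A₁ j i ≠ 0}.ncard = s := by
    unfold column
    by_cases hjd : j < d
    · simpa [hjd] using h₀.2 ⟨j, hjd⟩
    · have : j - d < d := by omega
      simpa [hjd, this] using h₁.2 ⟨j - d, this⟩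
  rw [columnList, List.length_map, ← List.toFinset_card_of_nodup ((List.nodup_finRange d).filter _),
    ← h, ← Set.ncard_coe_finset]
  congr 1
  ext i
  simp

lemma sum_map_columnList (j : ℕ) (i : Fin d) (c : ℝ) :
    ((columnList A₀ A₁ j).map fun p => if p.1 = (i : ℕ) then p.2 * c else 0).sum =
      column A₀ A₁ j i * c := by
  classical
  rw [columnList, List.map_map,
    ← List.sum_toFinset _ ((List.nodup_finRange d).filter _)]
  simp only [Function.comp_def, Fin.val_inj, Finset.sum_ite_eq']
  by_cases h : column A₀ A₁ j i = 0 <;> simp [h]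

lemma sum_range_getD {α : Type*} (l : List α) (x : α) (f : α → ℝ) :
    ∑ m ∈ Finset.range l.length, f (l.getD m x) = (l.map f).sum := by
  induction l with
  | nil => simp
  | cons a l ih =>
    rw [List.length_cons, Finset.sum_range_succ']
    simp only [List.getD_cons_succ, List.getD_cons_zero, ih]
    simp [add_comm]

lemma sum_range_mul_eq (s n : ℕ) (f : ℕ → ℝ) :
    ∑ e ∈ Finset.range (n * s), f e =
      ∑ j ∈ Finset.range n, ∑ m ∈ Finset.range s, f (j * s + m) := by
  induction n with
  | zero => simp
  | succ n ih => rw [add_mul, one_mul, Finset.sum_range_add, ih, Finset.sum_range_succ]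

lemma entry_eq {j m : ℕ} (hm : m < s) :
    entry s A₀ A₁ (j * s + m) = (columnList A₀ A₁ j).getD m (0, 0) := by
  rw [entry, mul_comm j, Nat.mul_add_div (by omega), Nat.mul_add_mod, Nat.mod_eq_of_lt hm,
    Nat.div_eq_of_lt hm, add_zero]

lemma entry_fst_lt (h₀ : IsSparseSign s A₀) (h₁ : IsSparseSign s A₁) {e : ℕ}
    (he : e < 2 * d * s) : (entry s A₀ A₁ e).1 < d := by
  have hs : 0 < s := Nat.pos_of_mul_pos_left (show 0 < 2 * d * s by omega)
  have hj : e / s < 2 * d := Nat.div_lt_of_lt_mul (by rwa [mul_comm])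
  have hm : e % s < (columnList A₀ A₁ (e / s)).length := by
    rw [length_columnList h₀ h₁ hj]
    exact Nat.mod_lt _ hs
  have hmem : entry s A₀ A₁ e ∈ columnList A₀ A₁ (e / s) := by
    rw [entry, List.getD_eq_getElem _ _ hm]
    exact List.getElem_mem hm
  obtain ⟨i, -, hi⟩ := List.mem_map.1 hmem
  rw [← hi]
  exact i.2

/-- Sparse matrix-vector multiplication takes time proportional to the number of non-zero
entries. -/
theorem evaluatesWithin_mulVecProg (hd : 0 < d) (hs : 0 < s) (h₀ : IsSparseSign s A₀)
    (h₁ : IsSparseSign s A₁) (x y : EuclideanSpace ℝ (Fin d)) {T : ℝ} (hT : 42 * (d * s) ≤ T) :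
    EvaluatesWithin mulVecProg s A₀ A₁ x y (A₀.toEuclideanLin x + A₁.toEuclideanLin y) T := by
  let z : ℕ → ℝ := fun j => if h : j < d then x ⟨j, h⟩ else if h : j - d < d then y ⟨j - d, h⟩ else 0
  obtain ⟨σ, h1, h2⟩ := exec_mulVecProg (σ := initState s A₀ A₁ x y) (d := d) (s := s)
    (row := fun e => (entry s A₀ A₁ e).1) (val := fun e => (entry s A₀ A₁ e).2) (z := z)
    (by simp [initState]) (by simp [initState]) (by simp [initState])
    (fun e => by
      have e1 : 16 + e ≠ 1 := by omega
      simp [initState, e1])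
    (fun j hj => by
      have e1 : 16 + d + j - (16 + 2 * d) = j - d := by omega
      simp only [initState, z, e1]
      rw [if_neg (by omega)]
      simp only [Nat.add_sub_cancel_left]
      split_ifs <;> first | rfl | omega)
    (fun e => by
      simp only [initState]
      rw [if_neg (by omega), dif_neg (by omega), dif_neg (by omega), Nat.add_sub_cancel_left])
    (fun i hi => by simp [initState, hi])
    (fun e he => entry_fst_lt h₀ h₁ he)
  refine ⟨_, σ, h1, le_trans ?_ hT, fun i => ?_⟩
  -- The count is `8 + 12d + 22ds`, and `8 + 12 + 22 = 42` with `d, s ≥ 1`.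
  · have : 7 + (2 * d * (4 + (s * 11 + 1) + 1) + 1) ≤ 42 * (d * s) := by
      nlinarith [Nat.mul_le_mul hd hs, Nat.mul_le_mul_left d hs]
    exact_mod_cast this
  · rw [h2 i i.2, sum_range_mul_eq]
    have hcol : ∀ j ∈ Finset.range (2 * d), ∑ m ∈ Finset.range s,
        (if (entry s A₀ A₁ (j * s + m)).1 = i then
          (entry s A₀ A₁ (j * s + m)).2 * z ((j * s + m) / s) else 0) =
        column A₀ A₁ j i * z j := by
      intro j hj
      rw [← sum_map_columnList, ← sum_range_getD _ (0, 0),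
        length_columnList h₀ h₁ (Finset.mem_range.1 hj)]
      refine Finset.sum_congr rfl fun m hm => ?_
      rw [Finset.mem_range] at hm
      rw [entry_eq hm, mul_comm j, Nat.mul_add_div (by omega), Nat.div_eq_of_lt hm, add_zero]
    rw [Finset.sum_congr rfl hcol, two_mul, Finset.sum_range_add, Finset.sum_range,
      Finset.sum_range]
    simp [column, z, Matrix.toLpLin_apply, Matrix.mulVec, dotProduct]

end Column

end SparseMap

namespace SparseMap

/-! ### Exponential moments over the random signs, for a fixed hash function. -/

section Chaos

variable {ι G : Type*} [DecidableEq G]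

/-- The sum of `u` over the members of `t` that `h` sends to the bucket `g`. -/
noncomputable def bucketSum (t : Finset ι) (h : ι → G) (u : ι → ℝ) (g : G) : ℝ :=
  ∑ i ∈ t, if h i = g then u i else 0

lemma bucketSum_insert [DecidableEq ι] {t : Finset ι} {i : ι} (hi : i ∉ t) (h : ι → G) (u : ι → ℝ) (g : G) :
    bucketSum (insert i t) h u g = (if h i = g then u i else 0) + bucketSum t h u g :=
  Finset.sum_insert hi

lemma sum_bucketSum [Fintype G] (t : Finset ι) (h : ι → G) (u : ι → ℝ) :
    ∑ g, bucketSum t h u g = ∑ i ∈ t, u i := by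
  unfold bucketSum
  rw [Finset.sum_comm]
  simp

/-- Adding one term to a bucket changes a weighted sum of squares of bucket sums only there. -/
lemma sum_mul_bucketSum_insert_sq [DecidableEq ι] [Fintype G] {t : Finset ι} {i : ι} (hi : i ∉ t) (h : ι → G) (u : ι → ℝ)
    (a : G → ℝ) :
    ∑ g, a g * bucketSum (insert i t) h u g ^ 2 =
      ∑ g, a g * bucketSum t h u g ^ 2 +
        a (h i) * (2 * u i * bucketSum t h u (h i) + u i ^ 2) := by
  have : ∀ g, a g * bucketSum (insert i t) h u g ^ 2 = a g * bucketSum t h u g ^ 2 +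
      if h i = g then a g * (2 * u i * bucketSum t h u g + u i ^ 2) else 0 := by
    intro g
    rw [bucketSum_insert hi]
    split_ifs <;> ring
  simp only [this, Finset.sum_add_distrib, Finset.sum_ite_eq, Finset.mem_univ, if_true]

/-- Averaging over one random sign. -/
lemma sum_exp_add_sign_mul_le [Fintype ι] [DecidableEq ι] (i : ι) (Q L : (ι → ℤˣ) → ℝ)
    (hQ : ∀ σ, Q (σ * Pi.mulSingle i (-1)) = Q σ)
    (hL : ∀ σ, L (σ * Pi.mulSingle i (-1)) = L σ) :
    ∑ σ, Real.exp (Q σ + ((σ i : ℤ) : ℝ) * L σ) ≤ ∑ σ, Real.exp (Q σ + L σ ^ 2 / 2) := by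
  -- Flipping the sign `i` permutes the sign vectors, so the sum can be paired with its mirror
  -- image; then `cosh u ≤ exp (u²/2)`.
  have hflip : ∑ σ, Real.exp (Q σ + ((σ i : ℤ) : ℝ) * L σ) =
      ∑ σ, Real.exp (Q σ - ((σ i : ℤ) : ℝ) * L σ) := by
    refine (Fintype.sum_equiv (Equiv.mulRight (Pi.mulSingle i (-1))) _ _ fun σ => ?_).symm
    simp only [Equiv.coe_mulRight, hQ, hL, Pi.mul_apply, Pi.mulSingle_eq_same]
    push_cast
    ring_nf
  have hpt : ∀ σ : ι → ℤˣ, Real.exp (Q σ + ((σ i : ℤ) : ℝ) * L σ) +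
      Real.exp (Q σ - ((σ i : ℤ) : ℝ) * L σ) ≤ 2 * Real.exp (Q σ + L σ ^ 2 / 2) := by
    intro σ
    have h1 : (((σ i : ℤ) : ℝ) * L σ) ^ 2 = L σ ^ 2 := by
      rcases Int.units_eq_one_or (σ i) with h | h <;> simp [h]
    have h2 := Real.cosh_le_exp_half_sq (((σ i : ℤ) : ℝ) * L σ)
    rw [h1, Real.cosh_eq] at h2
    rw [sub_eq_add_neg, Real.exp_add, Real.exp_add, Real.exp_add]
    nlinarith [Real.exp_pos (Q σ)]
  have := Finset.sum_le_sum fun σ (_ : σ ∈ Finset.univ) => hpt σ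
  rw [Finset.sum_add_distrib, ← hflip, ← Finset.mul_sum] at this
  linarith

/-- Exponential moments of the sum of the squares of random signed bucket sums. -/
theorem sum_exp_bucketSum_sq_le [Fintype ι] [DecidableEq ι] [Fintype G] (h : ι → G) (x : ι → ℝ) {B : ℝ} (t : Finset ι) (a : G → ℝ)
    (ha : ∀ g, |a g| + 2 * B ^ 2 * bucketSum t h (fun i => x i ^ 2) g ≤ B) :
    ∑ σ : ι → ℤˣ, Real.exp (∑ g, a g * bucketSum t h (fun i => ((σ i : ℤ) : ℝ) * x i) g ^ 2) ≤
      Fintype.card (ι → ℤˣ) * Real.exp (∑ g, a g * bucketSum t h (fun i => x i ^ 2) g +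
        B ^ 2 * (∑ g, bucketSum t h (fun i => x i ^ 2) g ^ 2 - ∑ i ∈ t, x i ^ 4)) := by
  -- Averaging out one sign changes the bucket weights, so `a` must vary in the induction.
  induction t using Finset.induction_on generalizing a with
  | empty => simp [bucketSum]
  | insert i t hi ih =>
    set v : G → ℝ := bucketSum t h fun i => x i ^ 2 with hv
    have hv0 : ∀ g, 0 ≤ v g := fun g =>
      Finset.sum_nonneg fun j _ => by split_ifs <;> positivity
    have hv' : ∀ g, bucketSum (insert i t) h (fun i => x i ^ 2) g =
        (if h i = g then x i ^ 2 else 0) + v g := fun g => bucketSum_insert hi h _ g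
    simp only [hv'] at ha
    have hai : a (h i) ^ 2 ≤ B ^ 2 := by
      have := ha (h i)
      rw [if_pos rfl] at this
      refine sq_le_sq' ?_ ?_ <;> nlinarith [neg_abs_le (a (h i)), le_abs_self (a (h i)), sq_nonneg (x i),
        mul_nonneg (sq_nonneg B) (add_nonneg (sq_nonneg (x i)) (hv0 (h i)))]
    -- The sign of `i` enters linearly with coefficient `L = 2 a x_i S`. The resulting `L²/2 = 2 a²
    -- x_i² S²` is again a multiple of the squared bucket sum and is absorbed into the weight. The
    -- growth `2 a² x_i² ≤ 2 B² x_i²` is paid for by the item leaving the bucket, so the hypothesis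
    -- on `a` persists.
    set a' : G → ℝ := fun g => a g + if h i = g then 2 * a (h i) ^ 2 * x i ^ 2 else 0 with ha'
    have key := ih a' fun g => by
      refine le_trans ?_ (ha g)
      simp only [ha']
      split_ifs with hg
      · subst hg
        have h1 := abs_add_le (a (h i)) (2 * a (h i) ^ 2 * x i ^ 2)
        rw [abs_of_nonneg (a := 2 * a (h i) ^ 2 * x i ^ 2) (by positivity)] at h1
        nlinarith [mul_le_mul_of_nonneg_right hai (sq_nonneg (x i))]
      · simp
    let S : (ι → ℤˣ) → G → ℝ := fun σ => bucketSum t h (fun i => ((σ i : ℤ) : ℝ) * x i)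
    have hS : ∀ σ, S (σ * Pi.mulSingle i (-1)) = S σ := by
      intro σ
      funext g
      refine Finset.sum_congr rfl fun j hj => ?_
      have : j ≠ i := fun hji => hi (hji ▸ hj)
      simp [Pi.mulSingle_eq_of_ne this]
    calc _ = ∑ σ : ι → ℤˣ, Real.exp ((∑ g, a g * S σ g ^ 2 + a (h i) * x i ^ 2) +
          ((σ i : ℤ) : ℝ) * (2 * a (h i) * x i * S σ (h i))) := by
          refine Finset.sum_congr rfl fun σ _ => ?_
          rw [sum_mul_bucketSum_insert_sq hi]
          have : (((σ i : ℤ) : ℝ)) ^ 2 = 1 := by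
            rcases Int.units_eq_one_or (σ i) with h | h <;> simp [h]
          congr 1
          rw [mul_pow, this]
          simp only [S]
          ring
      _ ≤ ∑ σ : ι → ℤˣ, Real.exp ((∑ g, a g * S σ g ^ 2 + a (h i) * x i ^ 2) +
          (2 * a (h i) * x i * S σ (h i)) ^ 2 / 2) :=
          sum_exp_add_sign_mul_le i _ _ (fun σ => by rw [hS]) (fun σ => by rw [hS])
      _ = Real.exp (a (h i) * x i ^ 2) * ∑ σ : ι → ℤˣ, Real.exp (∑ g, a' g * S σ g ^ 2) := by
          rw [Finset.mul_sum]
          refine Finset.sum_congr rfl fun σ _ => ?_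
          rw [← Real.exp_add]
          simp only [ha', add_mul, ite_mul, zero_mul, Finset.sum_add_distrib, Finset.sum_ite_eq,
            Finset.mem_univ, if_true]
          congr 1
          ring
      _ ≤ Real.exp (a (h i) * x i ^ 2) * (Fintype.card (ι → ℤˣ) * Real.exp (∑ g, a' g * v g +
            B ^ 2 * (∑ g, v g ^ 2 - ∑ i ∈ t, x i ^ 4))) := by gcongr
      _ = Fintype.card (ι → ℤˣ) * Real.exp (a (h i) * x i ^ 2 + (∑ g, a' g * v g +
            B ^ 2 * (∑ g, v g ^ 2 - ∑ i ∈ t, x i ^ 4))) := by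
          rw [Real.exp_add (a (h i) * x i ^ 2)]
          ring
      _ ≤ _ := by
          refine mul_le_mul_of_nonneg_left (Real.exp_le_exp.2 ?_) (Nat.cast_nonneg _)
          -- Inserting `i` raises `∑ v²` by `2 x_i² v + x_i⁴`; the fourth power cancels against `∑
          -- x⁴`, and `B²` times the rest dominates `2 a² x_i² v`.
          have h1 := sum_mul_bucketSum_insert_sq hi h (fun i => x i ^ 2) (fun _ => (1 : ℝ))
          simp only [one_mul] at h1
          rw [h1, Finset.sum_insert hi]
          simp only [hv', ha', add_mul, mul_add, ite_mul, mul_ite, zero_mul, mul_zero,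
            Finset.sum_add_distrib, Finset.sum_ite_eq, Finset.mem_univ, if_true]
          rw [← hv]
          nlinarith [mul_le_mul_of_nonneg_right hai (mul_nonneg (sq_nonneg (x i)) (hv0 (h i)))]

end Chaos

/-! ### Expected collision weight of a random hash function. -/

section Collision

variable {ι G : Type*} [Fintype ι] [DecidableEq ι] [Fintype G] [DecidableEq G]

/-- Two different items collide under a random function with probability `1 / |G|`. -/
lemma card_mul_sum_ite_eq [AddGroup G] {i j : ι} (hij : i ≠ j) :
    (Fintype.card G : ℝ) * ∑ h : ι → G, (if h i = h j then (1 : ℝ) else 0) =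
      Fintype.card (ι → G) := by
  -- Shifting the value at `i` by `c` permutes the functions, and for each `h` exactly one shift
  -- creates a collision with `j`.
  have hc : ∀ c : G, ∑ h : ι → G, (if h i = h j then (1 : ℝ) else 0) =
      ∑ h : ι → G, if h i + c = h j then (1 : ℝ) else 0 := by
    intro c
    refine (Fintype.sum_equiv (Equiv.addRight (Pi.single i c)) _ _ fun h => ?_).symm
    simp [Pi.single_eq_of_ne hij.symm]
  have : ∀ h : ι → G, ∑ c : G, (if h i + c = h j then (1 : ℝ) else 0) = 1 := by
    intro h
    simp_rw [show ∀ c : G, (h i + c = h j) = (c = -h i + h j) from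
      fun c => by rw [eq_neg_add_iff_add_eq]]
    simp
  calc _ = ∑ c : G, ∑ h : ι → G, (if h i = h j then (1 : ℝ) else 0) := by simp
    _ = ∑ c : G, ∑ h : ι → G, (if h i + c = h j then (1 : ℝ) else 0) :=
        Finset.sum_congr rfl fun c _ => hc c
    _ = _ := by
        rw [Finset.sum_comm]
        simp [this]

/-- The off-diagonal part of the sum of the squares of the bucket sums. -/
lemma sum_bucketSum_sq_sub (h : ι → G) (w : ι → ℝ) :
    ∑ g, bucketSum Finset.univ h w g ^ 2 - ∑ i, w i ^ 2 =
      ∑ i, ∑ j ∈ Finset.univ.erase i, w i * w j * if h i = h j then 1 else 0 := by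
  have h1 : ∑ g, bucketSum Finset.univ h w g ^ 2 =
      ∑ i, ∑ j, w i * w j * if h i = h j then 1 else 0 := by
    simp only [bucketSum, sq, Finset.sum_mul_sum]
    rw [Finset.sum_comm]
    refine Finset.sum_congr rfl fun i _ => ?_
    rw [Finset.sum_comm]
    refine Finset.sum_congr rfl fun j _ => ?_
    simp [ite_mul, mul_ite, eq_comm]
  rw [h1, ← Finset.sum_sub_distrib]
  refine Finset.sum_congr rfl fun i _ => ?_
  rw [← Finset.add_sum_erase _ _ (Finset.mem_univ i)]
  simp
  ring

/-- Each ordered pair of distinct items collides with probability `1/|G|`; restoring the diagonal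
pairs bounds the total weight by `(∑ w)² = 1`. -/
lemma card_mul_sum_bucketSum_sq_sub_le [AddGroup G] (w : ι → ℝ) (hw : ∀ i, 0 ≤ w i) (hw1 : ∑ i, w i = 1) :
    (Fintype.card G : ℝ) *
      ∑ h : ι → G, (∑ g, bucketSum Finset.univ h w g ^ 2 - ∑ i, w i ^ 2) ≤
        Fintype.card (ι → G) := by
  simp only [sum_bucketSum_sq_sub]
  rw [Finset.sum_comm, Finset.mul_sum]
  calc _ = ∑ i, ∑ j ∈ Finset.univ.erase i, w i * w j * (Fintype.card (ι → G) : ℝ) := by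
        refine Finset.sum_congr rfl fun i _ => ?_
        rw [Finset.sum_comm, Finset.mul_sum]
        refine Finset.sum_congr rfl fun j hj => ?_
        rw [← card_mul_sum_ite_eq (G := G) (Finset.ne_of_mem_erase hj).symm, ← Finset.mul_sum]
        ring
    _ ≤ ∑ i, ∑ j, w i * w j * (Fintype.card (ι → G) : ℝ) := by
        refine Finset.sum_le_sum fun i _ => ?_
        refine Finset.sum_le_sum_of_subset_of_nonneg (Finset.erase_subset _ _) fun j _ _ => ?_
        have := hw i
        have := hw j
        positivity
    _ = _ := by
        simp only [← Finset.sum_mul, ← Finset.mul_sum, hw1]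
        simp

end Collision

/-! ### Distortion of one block and concentration over `s` blocks. -/

section Block

variable {ι G : Type*} [Fintype ι] [DecidableEq ι] [Fintype G] [DecidableEq G] [AddGroup G]

/-- The squared norm of the image of `z` under the sketch with hash function `ω.1` and signs
`ω.2`. -/
noncomputable def sketchSq (z : ι → ℝ) (ω : (ι → G) × (ι → ℤˣ)) : ℝ :=
  ∑ g, bucketSum Finset.univ ω.1 (fun i => ((ω.2 i : ℤ) : ℝ) * z i) g ^ 2

/-- Exponential moments of the distortion of a unit vector under one random sketch. -/
theorem sum_exp_sketchSq_le (z : ι → ℝ) (hz : ∑ i, z i ^ 2 = 1) {θ : ℝ} (hθ : |θ| = 1 / 8) :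
    ∑ ω : (ι → G) × (ι → ℤˣ), Real.exp (θ * (sketchSq z ω - 1)) ≤
      Fintype.card ((ι → G) × (ι → ℤˣ)) * Real.exp (1 / (8 * Fintype.card G)) := by
  have hG : (0 : ℝ) < Fintype.card G := by
    have : 0 < Fintype.card G := Fintype.card_pos
    exact_mod_cast this
  let W : (ι → G) → ℝ := fun h =>
    ∑ g, bucketSum Finset.univ h (fun i => z i ^ 2) g ^ 2 - ∑ i, (z i ^ 2) ^ 2
  have hv0 : ∀ (h : ι → G) g, 0 ≤ bucketSum Finset.univ h (fun i => z i ^ 2) g := fun h g =>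
      Finset.sum_nonneg fun j _ => by split_ifs <;> positivity
  have hv1 : ∀ (h : ι → G) g, bucketSum Finset.univ h (fun i => z i ^ 2) g ≤ 1 := fun h g => by
    rw [← hz, ← sum_bucketSum Finset.univ h]
    exact Finset.single_le_sum (fun g _ => hv0 h g) (Finset.mem_univ g)
  have hW0 : ∀ h, 0 ≤ W h := by
    intro h
    simp only [W]
    rw [sum_bucketSum_sq_sub]
    refine Finset.sum_nonneg fun i _ => Finset.sum_nonneg fun j _ => ?_
    split_ifs <;> positivity
  have hW1 : ∀ h, W h ≤ 1 := by
    intro h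
    have h1 : ∑ g, bucketSum Finset.univ h (fun i => z i ^ 2) g ^ 2 ≤
        ∑ g, bucketSum Finset.univ h (fun i => z i ^ 2) g :=
      Finset.sum_le_sum fun g _ => by nlinarith [hv0 h g, hv1 h g]
    rw [sum_bucketSum, hz] at h1
    have h2 : 0 ≤ ∑ i, (z i ^ 2) ^ 2 := by positivity
    simp only [W]
    linarith
  have hσ : ∀ h : ι → G, ∑ σ : ι → ℤˣ, Real.exp (θ * (sketchSq z (h, σ) - 1)) ≤
      Fintype.card (ι → ℤˣ) * (1 + 1 / 8 * W h) := by
    intro h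
    -- Bucket masses are at most 1, so `|θ| + 2B² ≤ 1/8 + 1/8 = B`.
    have h1 := sum_exp_bucketSum_sq_le h z (B := 1 / 4) Finset.univ (fun _ => θ) fun g => by
      rw [hθ]
      linarith [hv1 h g]
    rw [← Finset.mul_sum, sum_bucketSum, hz, mul_one, Real.exp_add] at h1
    -- Linearizing, possible since `W ≤ 1`, leaves only the mean of `W` to be bounded.
    have h2 : Real.exp ((1 / 4) ^ 2 * W h) ≤ 1 + 1 / 8 * W h := by
      have h3 := Real.exp_bound' (x := (1 / 4) ^ 2 * W h) (by have := hW0 h; positivity)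
        (by linarith [hW1 h]) (n := 2) (by norm_num)
      norm_num [Finset.sum_range_succ, Nat.factorial] at h3
      norm_num
      nlinarith [hW0 h, hW1 h]
    have h4 : ∑ i, z i ^ 4 = ∑ i, (z i ^ 2) ^ 2 :=
      Finset.sum_congr rfl fun i _ => by ring
    rw [h4] at h1
    calc _ = Real.exp (-θ) * ∑ σ : ι → ℤˣ, Real.exp (∑ g, θ *
          bucketSum Finset.univ h (fun i => ((σ i : ℤ) : ℝ) * z i) g ^ 2) := by
          rw [Finset.mul_sum]
          refine Finset.sum_congr rfl fun σ _ => ?_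
          rw [← Real.exp_add, ← Finset.mul_sum]
          congr 1
          simp only [sketchSq]
          ring
      _ ≤ Real.exp (-θ) * (Fintype.card (ι → ℤˣ) *
          (Real.exp θ * Real.exp ((1 / 4) ^ 2 * W h))) := by gcongr
      _ = Fintype.card (ι → ℤˣ) * Real.exp ((1 / 4) ^ 2 * W h) := by
          rw [Real.exp_neg]
          field_simp
      _ ≤ _ := by gcongr
  rw [Fintype.sum_prod_type]
  have hW := card_mul_sum_bucketSum_sq_sub_le (G := G) (fun i => z i ^ 2)
    (fun i => sq_nonneg _) hz
  change (Fintype.card G : ℝ) * ∑ h, W h ≤ _ at hW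
  have hW' : ∑ h, W h ≤ Fintype.card (ι → G) * (1 / Fintype.card G) := by
    rw [mul_one_div, le_div_iff₀ hG]
    linarith
  calc _ ≤ ∑ h : ι → G, (Fintype.card (ι → ℤˣ) : ℝ) * (1 + 1 / 8 * W h) :=
        Finset.sum_le_sum fun h _ => hσ h
    _ = Fintype.card (ι → ℤˣ) * (Fintype.card (ι → G) + 1 / 8 * ∑ h, W h) := by
        rw [← Finset.mul_sum, Finset.sum_add_distrib, ← Finset.mul_sum]
        simp
    _ ≤ Fintype.card (ι → ℤˣ) * (Fintype.card (ι → G) +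
          1 / 8 * (Fintype.card (ι → G) * (1 / Fintype.card G))) := by gcongr
    _ = (Fintype.card (ι → G) * Fintype.card (ι → ℤˣ)) * (1 / (8 * Fintype.card G) + 1) := by
        field_simp
        ring
    _ ≤ _ := by
        rw [Fintype.card_prod, Nat.cast_mul]
        gcongr
        exact Real.add_one_le_exp _

/-- The total distortion of `s` independent sketches of a unit vector exceeds `s ε` with small
probability. -/
theorem card_filter_lt_mul_sum_sketchSq_le (s : ℕ) (z : ι → ℝ) (hz : ∑ i, z i ^ 2 = 1) {ε : ℝ}
    (hG : 2 ≤ ε * Fintype.card G) {θ : ℝ} (hθ : |θ| = 1 / 8) :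
    (((Finset.univ.filter fun ω : Fin s → (ι → G) × (ι → ℤˣ) =>
        s * ε / 8 < θ * ∑ b, (sketchSq z (ω b) - 1)).card : ℕ) : ℝ) ≤
      Fintype.card (Fin s → (ι → G) × (ι → ℤˣ)) * Real.exp (-(s * ε / 16)) := by
  set X := (ι → G) × (ι → ℤˣ)
  have hG0 : (0 : ℝ) < Fintype.card G := by
    have : 0 < Fintype.card G := Fintype.card_pos
    exact_mod_cast this
  have hmom : ∑ ω : Fin s → X, Real.exp (θ * ∑ b, (sketchSq z (ω b) - 1)) ≤
      Fintype.card (Fin s → X) * Real.exp (s * ε / 16) := by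
    have h1 : (1 : ℝ) / (8 * Fintype.card G) ≤ ε / 16 := by
      rw [div_le_div_iff₀ (by positivity) (by norm_num)]
      linarith
    calc _ = (∑ x : X, Real.exp (θ * (sketchSq z x - 1))) ^ s := by
          rw [Fintype.sum_pow]
          simp only [Finset.mul_sum, Real.exp_sum]
      _ ≤ (Fintype.card X * Real.exp (ε / 16)) ^ s := by
          gcongr
          exact (sum_exp_sketchSq_le z hz hθ).trans (by gcongr)
      _ = _ := by
          rw [mul_pow, ← Real.exp_nat_mul, Fintype.card_fun, Fintype.card_fin]
          push_cast
          ring_nf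
  set bad := Finset.univ.filter fun ω : Fin s → X =>
        s * ε / 8 < θ * ∑ b, (sketchSq z (ω b) - 1)
  have h2 : (bad.card : ℝ) * Real.exp (s * ε / 8) ≤
      ∑ ω : Fin s → X, Real.exp (θ * ∑ b, (sketchSq z (ω b) - 1)) := by
    rw [← nsmul_eq_mul]
    refine (Finset.card_nsmul_le_sum bad _ _ fun ω hω => ?_).trans
      (Finset.sum_le_sum_of_subset_of_nonneg (Finset.subset_univ bad) fun _ _ _ => by positivity)
    exact Real.exp_le_exp.2 (Finset.mem_filter.1 hω).2.le
  -- Markov's inequality: half of the threshold exponent `sε/8` is spent on the moment bound.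
  have h3 : Real.exp (s * ε / 16) = Real.exp (-(s * ε / 16)) * Real.exp (s * ε / 8) := by
    rw [← Real.exp_add]
    ring_nf
  rw [h3, ← mul_assoc] at hmom
  exact le_of_mul_le_mul_right (h2.trans hmom) (Real.exp_pos _)

/-- Two-sided version. -/
theorem card_filter_lt_abs_sum_sketchSq_le (s : ℕ) (z : ι → ℝ) (hz : ∑ i, z i ^ 2 = 1) {ε : ℝ}
    (hG : 2 ≤ ε * Fintype.card G) :
    (((Finset.univ.filter fun ω : Fin s → (ι → G) × (ι → ℤˣ) =>
        s * ε < |∑ b, (sketchSq z (ω b) - 1)|).card : ℕ) : ℝ) ≤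
      Fintype.card (Fin s → (ι → G) × (ι → ℤˣ)) * (2 * Real.exp (-(s * ε / 16))) := by
  have h1 := card_filter_lt_mul_sum_sketchSq_le (G := G) s z hz hG (θ := 1 / 8) (by norm_num)
  have h2 := card_filter_lt_mul_sum_sketchSq_le (G := G) s z hz hG (θ := -(1 / 8)) (by norm_num)
  refine le_trans ?_ ((add_le_add h1 h2).trans_eq (by ring))
  rw [← Nat.cast_add, Nat.cast_le]
  refine (Finset.card_le_card fun ω hω => ?_).trans (Finset.card_union_le _ _)
  rw [Finset.mem_filter, lt_abs] at hω
  rw [Finset.mem_union, Finset.mem_filter, Finset.mem_filter]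
  rcases hω.2 with h | h
  · exact Or.inl ⟨Finset.mem_univ _, by linarith⟩
  · exact Or.inr ⟨Finset.mem_univ _, by linarith⟩

end Block

end SparseMap

namespace SparseMap

/-! ### The sketches as sparse matrices and as a random linear map. -/

section Sketch

variable {ι G : Type*} {d s : ℕ}

/-- The matrix made of `s` scaled sketches, with the pair of block and bucket `p` in row `e p`. -/
noncomputable def sketchMatrix (e : Fin s × G ↪ Fin d) (ω : Fin s → (ι → G) × (ι → ℤˣ)) :
    Matrix (Fin d) ι ℝ :=
  fun r i => ∑ b, if e (b, (ω b).1 i) = r then (((ω b).2 i : ℤ) : ℝ) * (1 / √s) else 0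

variable (e : Fin s × G ↪ Fin d) (ω : Fin s → (ι → G) × (ι → ℤˣ))

lemma sketchMatrix_apply_embedding [DecidableEq G] (b : Fin s) (g : G) (i : ι) :
    sketchMatrix e ω (e (b, g)) i =
      if (ω b).1 i = g then (((ω b).2 i : ℤ) : ℝ) * (1 / √s) else 0 := by
  unfold sketchMatrix
  rw [Finset.sum_eq_single b]
  · simp
  · intro b' _ hb
    simp [hb]
  · simp

lemma sketchMatrix_apply_of_notMem_range {r : Fin d} (hr : r ∉ Set.range e) (i : ι) :
    sketchMatrix e ω r i = 0 :=
  Finset.sum_eq_zero fun _ _ => if_neg fun h => hr ⟨_, h⟩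

/-- A column has one non-zero entry per block, and injectivity of `e` keeps the blocks in disjoint
rows. -/
lemma isSparseSign_sketchMatrix_submatrix (hs : 0 < s) (f : Fin d → ι) :
    IsSparseSign s ((sketchMatrix e ω).submatrix id f) := by
  classical
  have h0 : (1 : ℝ) / √s ≠ 0 := by positivity
  refine ⟨fun r j => ?_, fun j => ?_⟩
  · simp only [Matrix.submatrix_apply, id]
    by_cases hr : r ∈ Set.range e
    · obtain ⟨⟨b, g⟩, rfl⟩ := hr
      rw [sketchMatrix_apply_embedding]
      split_ifs
      · rcases Int.units_eq_one_or ((ω b).2 (f j)) with h | h <;> simp [h]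
      · simp
    · exact Or.inr (Or.inl (sketchMatrix_apply_of_notMem_range e ω hr _))
  · have : {r | (sketchMatrix e ω).submatrix id f r j ≠ 0} =
        Set.range fun b => e (b, (ω b).1 (f j)) := by
      ext r
      simp only [Matrix.submatrix_apply, id, Set.mem_ofPred_eq, Set.mem_range]
      constructor
      · intro h
        obtain ⟨b, -, hb⟩ := Finset.exists_ne_zero_of_sum_ne_zero h
        exact ⟨b, by by_contra hne; exact hb (if_neg hne)⟩
      · rintro ⟨b, rfl⟩
        rw [sketchMatrix_apply_embedding, if_pos rfl]
        exact mul_ne_zero (by simp) h0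
    rw [this, ← Set.image_univ, Set.ncard_image_of_injective, Set.ncard_univ, Nat.card_fin]
    intro b b' h
    simpa using congrArg Prod.fst (e.injective h)

lemma sum_sketchMatrix_mulVec_sq [Fintype ι] [Fintype G] [DecidableEq G] (z : ι → ℝ) :
    ∑ r, (sketchMatrix e ω).mulVec z r ^ 2 = 1 / s * ∑ b, sketchSq z (ω b) := by
  have h1 : ∀ p : Fin s × G, (sketchMatrix e ω).mulVec z (e p) ^ 2 = 1 / s *
      bucketSum Finset.univ (ω p.1).1 (fun i => (((ω p.1).2 i : ℤ) : ℝ) * z i) p.2 ^ 2 := by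
    rintro ⟨b, g⟩
    have h2 : (1 / √s) ^ 2 = 1 / (s : ℝ) := by
      rw [div_pow, Real.sq_sqrt (Nat.cast_nonneg s), one_pow]
    rw [← h2, ← mul_pow, bucketSum, Finset.mul_sum]
    congr 1
    refine Finset.sum_congr rfl fun i _ => ?_
    change sketchMatrix e ω (e (b, g)) i * z i = _
    rw [sketchMatrix_apply_embedding]
    split_ifs <;> ring
  rw [← Fintype.sum_of_injective e e.injective _ _ (fun r hr => ?_) (fun p => (h1 p).symm),
    Fintype.sum_prod_type]
  · simp only [sketchSq, Finset.mul_sum]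
  · have : (sketchMatrix e ω).mulVec z r = 0 :=
      Finset.sum_eq_zero fun i _ =>
        mul_eq_zero_of_left (sketchMatrix_apply_of_notMem_range e ω hr i) _
    rw [this]
    simp

lemma sketchSq_const_mul [Fintype ι] [Fintype G] [DecidableEq G] (c : ℝ) (z : ι → ℝ)
    (ω : (ι → G) × (ι → ℤˣ)) : sketchSq (fun i => c * z i) ω = c ^ 2 * sketchSq z ω := by
  simp only [sketchSq, bucketSum, Finset.mul_sum (s := Finset.univ (α := G)), ← mul_pow]
  refine Finset.sum_congr rfl fun g _ => ?_
  congr 1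
  rw [Finset.mul_sum]
  refine Finset.sum_congr rfl fun i _ => ?_
  split_ifs <;> ring

end Sketch

/-- The map `(x, y) ↦ A₀ x + A₁ y` where `[A₀ | A₁]` is the sketch matrix. -/
noncomputable def sketchMap {G : Type*} {d s : ℕ} (e : Fin s × G ↪ Fin d)
    (ω : Fin s → (Fin d ⊕ Fin d → G) × (Fin d ⊕ Fin d → ℤˣ)) :
    (EuclideanSpace ℝ (Fin d) × EuclideanSpace ℝ (Fin d)) →ₗ[ℝ] EuclideanSpace ℝ (Fin d) :=
  ((sketchMatrix e ω).submatrix id Sum.inl).toEuclideanLin.coprod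
    ((sketchMatrix e ω).submatrix id Sum.inr).toEuclideanLin

lemma norm_sketchMap_sq {G : Type*} [DecidableEq G] [Fintype G] {d s : ℕ} (e : Fin s × G ↪ Fin d)
    (ω : Fin s → (Fin d ⊕ Fin d → G) × (Fin d ⊕ Fin d → ℤˣ)) (x y : EuclideanSpace ℝ (Fin d)) :
    ‖sketchMap e ω (x, y)‖ ^ 2 = 1 / s * ∑ b, sketchSq (Sum.elim x y) (ω b) := by
  rw [← sum_sketchMatrix_mulVec_sq e ω, EuclideanSpace.real_norm_sq_eq]
  refine Finset.sum_congr rfl fun r _ => ?_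
  simp [sketchMap, Matrix.toLpLin_apply, Matrix.mulVec, dotProduct]

/-- A lower bound for uniform probabilities from a bound on the number of exceptions. -/
lemma ofReal_one_sub_le_toOuterMeasure_uniformOfFintype {Ω : Type*} [Fintype Ω] [Nonempty Ω]
    (S : Set Ω) (bad : Finset Ω) {δ : ℝ} (hS : ∀ ω ∉ bad, ω ∈ S)
    (h : (bad.card : ℝ) ≤ Fintype.card Ω * δ) :
    ENNReal.ofReal (1 - δ) ≤ (PMF.uniformOfFintype Ω).toOuterMeasure S := by
  classical
  have hΩ : (0 : ℝ) < Fintype.card Ω := by exact_mod_cast Fintype.card_pos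
  have h1 : (Fintype.card Ω : ℝ) ≤ bad.card + Fintype.card S := by
    rw [← Set.toFinset_card, ← Nat.cast_add, Nat.cast_le, ← Finset.card_univ]
    refine (Finset.card_le_card fun ω _ => ?_).trans (Finset.card_union_le _ _)
    by_cases hω : ω ∈ bad
    · simp [hω]
    · simp [hS ω hω]
  rw [PMF.toOuterMeasure_uniformOfFintype_apply, ← ENNReal.ofReal_natCast (Fintype.card S),
    ← ENNReal.ofReal_natCast (Fintype.card Ω), ← ENNReal.ofReal_div_of_pos hΩ]
  refine ENNReal.ofReal_le_ofReal ?_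
  rw [le_div_iff₀ hΩ]
  linarith

/-- A random sketch map preserves the norm of a fixed vector up to a factor `1 ± ε`, except with
probability `2 exp (-s ε / 16)`. -/
theorem ofReal_le_toOuterMeasure_norm_sketchMap_sq {G : Type*} [AddGroup G] [DecidableEq G]
    [Fintype G] {d s : ℕ} (hs : 0 < s) (e : Fin s × G ↪ Fin d) {ε : ℝ}
    (hG : 2 ≤ ε * Fintype.card G) (x y : EuclideanSpace ℝ (Fin d)) :
    ENNReal.ofReal (1 - 2 * Real.exp (-(s * ε / 16))) ≤
      ((PMF.uniformOfFintype (Fin s → (Fin d ⊕ Fin d → G) × (Fin d ⊕ Fin d → ℤˣ))).map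
        (sketchMap e)).toOuterMeasure {φ | (1 - ε) * (‖x‖ ^ 2 + ‖y‖ ^ 2) ≤ ‖φ (x, y)‖ ^ 2 ∧
          ‖φ (x, y)‖ ^ 2 ≤ (1 + ε) * (‖x‖ ^ 2 + ‖y‖ ^ 2)} := by
  rw [PMF.toOuterMeasure_map_apply]
  -- The zero vector cannot be normalized, but every linear map preserves its norm.
  rcases eq_or_ne (‖x‖ ^ 2 + ‖y‖ ^ 2) 0 with h0 | h0
  · have hx : x = 0 := norm_eq_zero.1 (by nlinarith [sq_nonneg ‖x‖, sq_nonneg ‖y‖])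
    have hy : y = 0 := norm_eq_zero.1 (by nlinarith [sq_nonneg ‖x‖, sq_nonneg ‖y‖])
    refine ofReal_one_sub_le_toOuterMeasure_uniformOfFintype _ ∅ (fun ω _ => ?_) ?_
    · subst hx hy
      change _ ∧ _
      rw [Prod.mk_zero_zero, map_zero]
      simp
    · simp only [Finset.card_empty, Nat.cast_zero]
      positivity
  · set q := ‖x‖ ^ 2 + ‖y‖ ^ 2 with hq
    have hq0 : 0 < q := lt_of_le_of_ne (by positivity) h0.symm
    let z : Fin d ⊕ Fin d → ℝ := fun i => 1 / √q * Sum.elim x y i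
    have hsq : (1 / √q) ^ 2 = 1 / q := by rw [div_pow, Real.sq_sqrt hq0.le, one_pow]
    have hz : ∑ i, z i ^ 2 = 1 := by
      simp only [z, mul_pow, hsq, ← Finset.mul_sum, Fintype.sum_sum_type, Sum.elim_inl,
        Sum.elim_inr, ← EuclideanSpace.real_norm_sq_eq]
      rw [← hq]
      field_simp
    refine ofReal_one_sub_le_toOuterMeasure_uniformOfFintype _ _ (fun ω hω => ?_)
      (card_filter_lt_abs_sum_sketchSq_le s z hz hG)
    simp only [Finset.mem_filter, Finset.mem_univ, true_and, not_lt] at hω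
    change _ ≤ ‖sketchMap e ω (x, y)‖ ^ 2 ∧ ‖sketchMap e ω (x, y)‖ ^ 2 ≤ _
    have hsum : ∑ b, (sketchSq z (ω b) - 1) = s * (‖sketchMap e ω (x, y)‖ ^ 2 / q - 1) := by
      rw [norm_sketchMap_sq]
      simp only [z, sketchSq_const_mul, hsq, ← Finset.mul_sum, Finset.sum_sub_distrib]
      simp
      field_simp
    have hs' : (0 : ℝ) < s := by exact_mod_cast hs
    rw [hsum, abs_mul, abs_of_pos hs', mul_le_mul_iff_right₀ hs', abs_le] at hω
    rw [← le_div_iff₀ hq0, ← div_le_iff₀ hq0]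
    exact ⟨by linarith [hω.1], by linarith [hω.2]⟩

end SparseMap

/-! ### Choice of parameters. -/

theorem mainTheorem7 :
    ∃ (P : RealRAM.Prog) (Cs Ct : ℝ), 0 < Cs ∧ 0 < Ct ∧
      ∀ c : ℝ, 0 < c → ∃ Cd : ℝ, 0 < Cd ∧
        ∀ (n : ℕ) (ε : ℝ) (d : ℕ), 2 ≤ n → 0 < ε → ε ≤ 1 →
          Cd * (Real.log n / ε ^ 2) ≤ (d : ℝ) →
          ∃ (s : ℕ) (F : PMF ((EuclideanSpace ℝ (Fin d) × EuclideanSpace ℝ (Fin d)) →ₗ[ℝ]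
              EuclideanSpace ℝ (Fin d))),
            0 < s ∧ (s : ℝ) ≤ Cs * (d * ε) ∧
            (∀ φ ∈ F.support, ∃ A₀ A₁ : Matrix (Fin d) (Fin d) ℝ,
              SparseMap.IsSparseSign s A₀ ∧ SparseMap.IsSparseSign s A₁ ∧
              ∀ x y : EuclideanSpace ℝ (Fin d),
                φ (x, y) = A₀.toEuclideanLin x + A₁.toEuclideanLin y ∧
                SparseMap.EvaluatesWithin P s A₀ A₁ x y (φ (x, y)) (Ct * (d ^ 2 * ε)) ∧
                ∀ D : ℝ, (d : ℝ) ≤ D * (Real.log n / ε ^ 2) →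
                  SparseMap.EvaluatesWithin P s A₀ A₁ x y (φ (x, y))
                    (Ct * D ^ 2 * (Real.log n ^ 2 / ε ^ 3))) ∧
            ∀ x y : EuclideanSpace ℝ (Fin d),
              ENNReal.ofReal (1 - (n : ℝ) ^ (-c)) ≤
                F.toOuterMeasure {φ | (1 - ε) * (‖x‖ ^ 2 + ‖y‖ ^ 2) ≤ ‖φ (x, y)‖ ^ 2 ∧
                  ‖φ (x, y)‖ ^ 2 ≤ (1 + ε) * (‖x‖ ^ 2 + ‖y‖ ^ 2)} := by
  -- Here `96 = 16 · 6`: 16 from the tail bound, 6 from `dε² ≤ 6sε`. The extra 1 in `c + 1` will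
  -- absorb the factor 2 of the union bound.
  refine ⟨SparseMap.mulVecProg, 1, 42, one_pos, by norm_num, fun c hc => ⟨96 * (c + 1),
    by positivity, fun n ε d hn hε hε1 hd => ?_⟩⟩
  have hn' : (2 : ℝ) ≤ n := by exact_mod_cast hn
  have hn0 : (0 : ℝ) < n := by linarith
  have hL : (1 / 2 : ℝ) ≤ Real.log n := by
    have := Real.log_le_log two_pos hn'
    linarith [Real.log_two_gt_d9]
  have hdε : 96 * (c + 1) * Real.log n ≤ d * ε ^ 2 := by
    rwa [← mul_div_assoc, div_le_iff₀ (by positivity)] at hd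
  have hd48 : 48 ≤ d * ε ^ 2 := by nlinarith [mul_pos hc (show 0 < Real.log n by linarith)]
  set k := ⌈2 / ε⌉₊
  have hk2 : 2 / ε ≤ k := Nat.le_ceil _
  have hk3 : (k : ℝ) * ε ≤ 3 := by
    have h1 : (k : ℝ) < 2 / ε + 1 := Nat.ceil_lt_add_one (by positivity)
    have h2 : (2 / ε + 1) * ε = 2 + ε := by field_simp
    nlinarith
  have hk2' : 2 ≤ ε * k := by
    rw [div_le_iff₀ hε] at hk2
    linarith
  have hk0 : 0 < k := Nat.ceil_pos.2 (by positivity)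
  have : NeZero k := ⟨hk0.ne'⟩
  -- At least one block fits: `kε² ≤ kε ≤ 3 ≤ 48 ≤ dε²`.
  have hkd : k ≤ d := by
    have h2 : (k : ℝ) * ε ^ 2 ≤ d * ε ^ 2 := by nlinarith
    exact_mod_cast le_of_mul_le_mul_right h2 (by positivity)
  set s := d / k with hs
  have hs0 : 0 < s := Nat.div_pos hkd hk0
  have hs1 : (1 : ℝ) ≤ s := by exact_mod_cast hs0
  have hskd : s * k ≤ d := Nat.div_mul_le_self d k
  have hskd' : (s : ℝ) * k ≤ d := by exact_mod_cast hskd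
  have hds : (d : ℝ) ≤ (s + 1) * k := by
    have : d < (s + 1) * k := by
      rw [add_mul, one_mul]
      exact Nat.lt_div_mul_add hk0
    exact_mod_cast this.le
  have hsd : (s : ℝ) ≤ d * ε := by nlinarith
  have hsε : d * ε ^ 2 ≤ 6 * (s * ε) := by
    have h1 : d * ε ≤ 6 * s := by
      calc d * ε ≤ (s + 1) * k * ε := by gcongr
        _ = (s + 1) * (k * ε) := by ring
        _ ≤ (s + 1) * 3 := by gcongr
        _ ≤ 6 * s := by linarith
    nlinarith
  -- `ZMod k` supplies the group structure used in the collision count; rows outside the image of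
  -- `e` stay zero.
  obtain ⟨e⟩ : Nonempty (Fin s × ZMod k ↪ Fin d) :=
    Function.Embedding.nonempty_of_card_le (by simpa [ZMod.card] using hskd)
  have hT : 42 * (d * s : ℝ) ≤ 42 * (d ^ 2 * ε) := by
    have := mul_le_mul_of_nonneg_left hsd (Nat.cast_nonneg (α := ℝ) d)
    nlinarith
  have hd0 : 0 < d := hk0.trans_le hkd
  refine ⟨s, (PMF.uniformOfFintype _).map (SparseMap.sketchMap e), hs0, by rwa [one_mul], ?_, ?_⟩
  · intro φ hφ
    obtain ⟨ω, -, rfl⟩ := (PMF.mem_support_map_iff _ _ _).1 hφ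
    have h₀ := SparseMap.isSparseSign_sketchMatrix_submatrix e ω hs0 Sum.inl
    have h₁ := SparseMap.isSparseSign_sketchMatrix_submatrix e ω hs0 Sum.inr
    refine ⟨_, _, h₀, h₁, fun x y => ⟨rfl,
      SparseMap.evaluatesWithin_mulVecProg hd0 hs0 h₀ h₁ x y hT, fun D hD =>
      SparseMap.evaluatesWithin_mulVecProg hd0 hs0 h₀ h₁ x y (hT.trans ?_)⟩⟩
    calc 42 * ((d : ℝ) ^ 2 * ε) ≤ 42 * ((D * (Real.log n / ε ^ 2)) ^ 2 * ε) := by gcongr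
      _ = _ := by field_simp
  · intro x y
    refine le_trans (ENNReal.ofReal_le_ofReal ?_)
      (SparseMap.ofReal_le_toOuterMeasure_norm_sketchMap_sq hs0 e (by simpa [ZMod.card]) x y)
    have h1 : Real.exp (-(s * ε / 16)) ≤ Real.exp (Real.log n * -c) * Real.exp (-Real.log n) := by
      rw [← Real.exp_add]
      refine Real.exp_le_exp.2 ?_
      linarith
    rw [← Real.rpow_def_of_pos hn0, Real.exp_neg (Real.log n),
      Real.exp_log hn0] at h1
    -- The spare factor `1/n ≤ 1/2` cancels the 2 from the two-sided tail.
    have h2 : (n : ℝ) ^ (-c) * (n : ℝ)⁻¹ ≤ (n : ℝ) ^ (-c) * 2⁻¹ := by gcongr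
    linarith
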